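/- Let $n\ge 0$ and $d\ge 1$ be integers and $\ell=\sqrt{2\pi/d}$. For $h>0$ write $\mathbb T_h^m=(-h/2,h/2]^m$. Let $\hat\rho$ be a positive trace-class operator on $L^2(\mathbb R^n)$ (for example a density operator, $\operatorname{Tr}\hat\rho=1$: the state of $n$ bosonic modes with position operators $\hat{\mathbf q}$ and momentum operators $\hat{\mathbf p}$, $[\hat q_k,\hat p_l]=i\delta_{kl}$). **Modular measurement.** The outcomes are the points of $\mathcal X^n$, $\mathcal X=\{\ell(u-\lfloor d/2\rfloor):u=0,\dots,d-1\}$. For $\bar{\mathbf x}\in\mathcal X^n$ let $\hat{\tilde K}_{\bar{\mathbf x}}=\int_{\mathbb T_\ell^n}|\hat{\mathbf q}=\bar{\mathbf x}+\mathbf s\rangle\langle\hat{\mathbf q}=\bar{\mathbf x}+\mathbf s|\,d\mathbf s$ be the projection onto positions in $\bar{\mathbf x}+\mathbb T_\ell^n$, and $$\hat K_{\bar{\mathbf x}}=\sum_{\mathbf m\in\mathbb Z^n}\hat X(\ell d\mathbf m)\,\hat{\tilde K}_{\bar{\mathbf x}}\,\hat X^\dagger(\ell d\mathbf m),\qquad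 \hat X(\mathbf s)=e^{-i\mathbf s\cdot\hat{\mathbf p}},$$ where the sum converges strongly. The binned modular homodyne statistics of $\hat\rho$ are $p_M(\bar{\mathbf x})=\operatorname{Tr}(\hat K_{\bar{\mathbf x}}\hat\rho)$. **Stabilizer subsystem decomposition.** For $\mathbf a\in\{0,\dots,d-1\}^n$ let $|\mathbf a_{\rm GKP}\rangle=\sum_{\mathbf m\in\mathbb Z^n}|\hat{\mathbf q}=\ell(d\mathbf m+\mathbf a)\rangle$, let $\hat\Pi=\sum_{\mathbf a}|\mathbf a\rangle\langle\mathbf a_{\rm GKP}|$, and for $\mathbf t=(\mathbf t_q,\mathbf t_p)\in\mathbb R^{2n}$ let $\hat D(\mathbf t)=e^{i(\mathbf t_q\cdot\hat{\mathbf p}-\mathbf t_p\cdot\hat{\mathbf q})}$. Define $$\operatorname{Tr}_S(\hat\rho)=\frac1{\ell^n}\int_{\mathbb T_\ell^{2n}}d\mathbf t\;\hat\Pi\,\hat D(\mathbf t)\,\hat\rho\,\hat D^\dagger(\mathbf t)\,\hat\Pi^\dagger ,$$ a matrix in the computational basis $|\mathbf a\rangle$ of $n$ qudits of dimension $d$.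 Here, for $\psi\in L^2(\mathbb R^n)$, the amplitude $\langle\mathbf a_{\rm GKP}|\hat D(\mathbf t)\psi\rangle=\sum_{\mathbf m}(\hat D(\mathbf t)\psi)(\ell(d\mathbf m+\mathbf a))$ is understood as a sum converging unconditionally in $L^2(\mathbb T_\ell^{2n},d\mathbf t)$, and for $\hat\rho=\sum_k|\varphi_k\rangle\langle\varphi_k|$ with $\sum_k\|\varphi_k\|^2<\infty$ the integrand is $\sum_k(\hat\Pi\hat D(\mathbf t)\varphi_k)(\hat\Pi\hat D(\mathbf t)\varphi_k)^\dagger$. **Claim.** $\operatorname{Tr}_S(\hat\rho)$ is well defined: decompositions $\hat\rho=\sum_k|\varphi_k\rangle\langle\varphi_k|$ as above exist, and for each of them the amplitude series and the $k$-series (for almost every $\mathbf t$) converge, the integrand is integrable, and the value does not depend on the decomposition. It is a positive semidefinite matrix of trace $\operatorname{Tr}\hat\rho$. Put $\{a\}_d=((a+\lfloor d/2\rfloor)\bmod d)-\lfloor d/2\rfloor$. Then $\mathbf a\mapsto\ell\{\mathbf a\}_d=(\ell\{a_1\}_d,\dots,\ell\{a_n\}_d)$ is a bijection from $\{0,\dots,d-1\}^n$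 onto $\mathcal X^n$, and for every $\mathbf a\in\{0,\dots,d-1\}^n$ the sum defining $\hat K_{\ell\{\mathbf a\}_d}$ converges strongly and $$p_M(\ell\{\mathbf a\}_d)=\operatorname{Tr}\big(\hat K_{\ell\{\mathbf a\}_d}\hat\rho\big)=\langle\mathbf a|\operatorname{Tr}_S(\hat\rho)|\mathbf a\rangle .$$ That is, the binned modular homodyne statistics of $\hat\rho$ are exactly the computational-basis statistics of its stabilizer subsystem decomposition. -/

import Mathlib

open MeasureTheory Filter Topology
open scoped ENNReal ComplexOrder

noncomputable section

/-- The Hilbert space `L²(ℝⁿ)` of `n` bosonic modes, in the position representation. -/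
abbrev CVSpace (n : ℕ) : Type := Lp ℂ 2 (volume : Measure (Fin n → ℝ))

/-- `T` has trace `c`: the diagonal sums converge to `c` in every orthonormal basis.
(Such a `c` exists exactly for trace-class operators.) -/
def HasTrace {n : ℕ} (T : CVSpace n →L[ℂ] CVSpace n) (c : ℂ) : Prop :=
  ∀ (κ : Type) (b : HilbertBasis κ ℂ (CVSpace n)), HasSum (fun i => inner ℂ (b i) (T (b i))) c

/-- The lattice spacing `ℓ = √(2π/d)`. -/
def gridSpacing (d : ℕ) : ℝ := Real.sqrt (2 * Real.pi / d)

/-- The half-open cube `𝕋_ℓⁿ = (-ℓ/2, ℓ/2]ⁿ`. -/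
def cube (n d : ℕ) : Set (Fin n → ℝ) :=
  Set.univ.pi fun _ => Set.Ioc (-(gridSpacing d) / 2) (gridSpacing d / 2)

lemma measurableSet_cube (n d : ℕ) : MeasurableSet (cube n d) :=
  MeasurableSet.univ_pi fun _ => measurableSet_Ioc

/-- The cell `𝕋_ℓ²ⁿ` of phase space; a phase-space vector is written as the pair of its position
part and its momentum part. -/
def phaseCell (n d : ℕ) : Set ((Fin n → ℝ) × (Fin n → ℝ)) := cube n d ×ˢ cube n d

/-! ### Binned modular homodyne measurement -/

/-- The projection `∫_S |q = y⟩⟨q = y| dy` onto positions in `S`, that is, multiplication by the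
indicator function of `S`. -/
def positionProj {n : ℕ} (S : Set (Fin n → ℝ)) (hS : MeasurableSet S) :
    CVSpace n →L[ℂ] CVSpace n :=
  LinearMap.mkContinuous
    { toFun := fun ψ => ((Lp.memLp ψ).indicator hS).toLp (S.indicator ψ)
      map_add' := by
        intro f g
        rw [← MemLp.toLp_add, MemLp.toLp_eq_toLp_iff]
        filter_upwards [AEEqFun.coeFn_add (f : (Fin n → ℝ) →ₘ[volume] ℂ) g] with x hx
        by_cases h : x ∈ S <;> simp [h, hx]
      map_smul' := by
        intro c f
        rw [RingHom.id_apply, ← MemLp.toLp_const_smul, MemLp.toLp_eq_toLp_iff]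
        filter_upwards [Lp.coeFn_smul c f] with x hx
        by_cases h : x ∈ S <;> simp [h, hx] }
    1 (by
      intro f
      rw [one_mul]
      refine Lp.norm_le_norm_of_ae_le ?_
      filter_upwards [((Lp.memLp f).indicator hS).coeFn_toLp] with x hx
      simp only [LinearMap.coe_mk, AddHom.coe_mk]
      rw [hx]
      exact norm_indicator_le_norm_self _ _)

/-- The translation `X(s) = exp(-i s·p̂)`, `(X(s)ψ)(y) = ψ(y - s)`. -/
def translation {n : ℕ} (s : Fin n → ℝ) : CVSpace n →L[ℂ] CVSpace n :=
  (Lp.compMeasurePreservingₗᵢ ℂ (fun y : Fin n → ℝ => y - s)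
    (measurePreserving_sub_right volume s)).toContinuousLinearMap

/-- The bin `x + 𝕋_ℓⁿ` centred at `x`. -/
def bin {n : ℕ} (d : ℕ) (x : Fin n → ℝ) : Set (Fin n → ℝ) := (fun y => y - x) ⁻¹' cube n d

lemma measurableSet_bin {n : ℕ} (d : ℕ) (x : Fin n → ℝ) : MeasurableSet (bin d x) :=
  (measurableSet_cube n d).preimage (measurable_sub_const x)

/-- The non-modular measurement operator `K̃_x = ∫_{𝕋_ℓⁿ} |q = x + s⟩⟨q = x + s| ds`. -/
def binOperator {n : ℕ} (d : ℕ) (x : Fin n → ℝ) : CVSpace n →L[ℂ] CVSpace n :=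
  positionProj (bin d x) (measurableSet_bin d x)

/-- `K` is the modular measurement operator `K_x = ∑_{m ∈ ℤⁿ} X(ℓdm) K̃_x X(ℓdm)†`
(the sum converging strongly). -/
def IsModularBinOperator {n : ℕ} (d : ℕ) (x : Fin n → ℝ) (K : CVSpace n →L[ℂ] CVSpace n) : Prop :=
  ∀ ψ : CVSpace n,
    HasSum (fun m : Fin n → ℤ =>
      let X : CVSpace n →L[ℂ] CVSpace n := translation fun j => gridSpacing d * d * m j
      X (binOperator d x (ContinuousLinearMap.adjoint X ψ))) (K ψ)

/-- The set `𝒳ⁿ` of measurement outcomes, `𝒳 = {ℓ (u - ⌊d/2⌋) : u = 0, …, d - 1}`. -/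
def outcomes (n d : ℕ) : Set (Fin n → ℝ) :=
  {x | ∀ j, ∃ u : Fin d, x j = gridSpacing d * (((u : ℕ) : ℝ) - ((d / 2 : ℕ) : ℝ))}

/-- The centred residue `{a}_d = (a + ⌊d/2⌋) mod d - ⌊d/2⌋`. -/
def centredResidue (d : ℕ) (a : Fin d) : ℤ :=
  (((a : ℕ) + d / 2) % d : ℕ) - (d / 2 : ℕ)

/-- The outcome `x̄ = ℓ ({a₁}_d, …, {aₙ}_d)` corresponding to the basis state `|a⟩`. -/
def outcomeOf {n d : ℕ} (a : Fin n → Fin d) : Fin n → ℝ :=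
  fun j => gridSpacing d * centredResidue d (a j)

/-! ### Stabilizer subsystem decomposition -/

/-- The displacement `D(t) = exp(i tᵀΩr̂) = exp(i (t_q·p̂ - t_p·q̂))` acting on wave functions:
`(D(t)f)(x) = exp(-i t_p·x - i t_p·t_q/2) f(x + t_q)`. -/
def displacement {n : ℕ} (t : (Fin n → ℝ) × (Fin n → ℝ)) (f : (Fin n → ℝ) → ℂ) :
    (Fin n → ℝ) → ℂ :=
  fun x => Complex.exp (-Complex.I * ((∑ j, t.2 j * x j + (∑ j, t.2 j * t.1 j) / 2 : ℝ) : ℂ)) *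
    f (x + t.1)

/-- The position `ℓ (d m + a)` of a tooth of the Dirac comb `|a_GKP⟩ = ∑ₘ |q = ℓ (d m + a)⟩`. -/
def combPoint {n d : ℕ} (a : Fin n → Fin d) (m : Fin n → ℤ) : Fin n → ℝ :=
  fun j => gridSpacing d * (d * m j + (a j : ℕ))

/-- `A` is the function `t ↦ ⟨a_GKP| D(t) |ψ⟩ = ∑ₘ (D(t)ψ)(ℓ (d m + a))` on the cell `𝕋_ℓ²ⁿ`, the
`a`-component of `Π D(t) ψ`. For a general `ψ ∈ L²(ℝⁿ)` the sum over `m ∈ ℤⁿ` does not converge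
absolutely; it converges unconditionally in mean square over the cell, and this determines `A`
almost everywhere on the cell. -/
def IsGKPAmplitude {n d : ℕ} (a : Fin n → Fin d) (ψ : CVSpace n)
    (A : (Fin n → ℝ) × (Fin n → ℝ) → ℂ) : Prop :=
  MemLp A 2 (volume.restrict (phaseCell n d)) ∧
  Tendsto (fun s : Finset (Fin n → ℤ) =>
      eLpNorm (fun t => ∑ m ∈ s, displacement t ψ (combPoint a m) - A t) 2
        (volume.restrict (phaseCell n d)))
    atTop (𝓝 0)

/-- `ρ = ∑ₖ |φₖ⟩⟨φₖ|` with `∑ₖ ‖φₖ‖² < ∞`: the (unnormalized) vectors `φₖ` form a pure-state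
ensemble for `ρ`. Finite ensembles are extended by zeros. -/
def IsEnsemble {n : ℕ} (ρ : CVSpace n →L[ℂ] CVSpace n) (φ : ℕ → CVSpace n) : Prop :=
  Summable (fun k => ‖φ k‖ ^ 2) ∧
  ∀ ψ : CVSpace n, HasSum (fun k => inner ℂ (φ k) ψ • φ k) (ρ ψ)

/-- `M` is the stabilizer subsystem decomposition
`Tr_S(ρ) = ℓ⁻ⁿ ∫_{𝕋_ℓ²ⁿ} Π D(t) ρ D(t)† Π† dt` of `ρ`, as a matrix in the computational basis of
`n` qudits of dimension `d`. The integrand is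
`Π D(t) ρ D(t)† Π† = ∑ₖ (Π D(t) φₖ) (Π D(t) φₖ)†` for `ρ = ∑ₖ |φₖ⟩⟨φₖ|`; the formula is required
to make sense and to give `M` for each such ensemble. -/
def IsSSD {n d : ℕ} (ρ : CVSpace n →L[ℂ] CVSpace n)
    (M : Matrix (Fin n → Fin d) (Fin n → Fin d) ℂ) : Prop :=
  (∃ φ : ℕ → CVSpace n, IsEnsemble ρ φ) ∧
  ∀ φ : ℕ → CVSpace n, IsEnsemble ρ φ →
    ∃ A : ℕ → (Fin n → Fin d) → (Fin n → ℝ) × (Fin n → ℝ) → ℂ,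
      (∀ k a, IsGKPAmplitude a (φ k) (A k a)) ∧
      ∀ a b : Fin n → Fin d,
        (∀ᵐ t ∂(volume.restrict (phaseCell n d)),
          Summable fun k => A k a t * (starRingEnd ℂ) (A k b t)) ∧
        IntegrableOn (fun t => ∑' k, A k a t * (starRingEnd ℂ) (A k b t)) (phaseCell n d) ∧
        M a b = ((gridSpacing d ^ n)⁻¹ : ℝ) *
          ∫ t in phaseCell n d, ∑' k, A k a t * (starRingEnd ℂ) (A k b t)

end

/-!
The combs `|a_GKP⟩`, for `a ∈ {0, …, d-1}ⁿ`, split the lattice `ℓ ℤⁿ`, and the bins `y + 𝕋_ℓⁿ` around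
the lattice points `y` tile position space. Let `K_a` be the projection onto the union of the bins
at the teeth of `|a_GKP⟩` (`combProj`). As `ℓ {a}_d` is a tooth of `|a_GKP⟩`, the sum over
translations by `ℓ d m` that defines the modular measurement operator at this outcome runs over
these bins, and it converges strongly to `K_a` (`isModularBinOperator_combProj`).

On the cell `𝕋_ℓ²ⁿ`, the amplitude `⟨a_GKP| D(t) |ψ⟩` is a Fourier series in the momentum shift
`t_p`: up to a common phase, the tooth `m` contributes `exp(-i ℓ d t_p·m) ψ(ℓ (d m + a) + t_q)`. As
`ℓ² d = 2π`, these characters are orthogonal on the momentum cell, so that the contributions of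
different teeth are orthogonal, and the tooth `m` has squared norm `ℓⁿ` times that of `ψ` on its bin
(`inner_toothLinearMap_combPoint`). Hence the series converges unconditionally in `L²` of the cell
to a bounded linear function `V_a ψ` of `ψ`, and `⟨V_a ψ, V_a φ⟩ = ℓⁿ ⟨ψ, K_a φ⟩`
(`inner_combAmplitude`).

For `ρ = ∑ₖ |φₖ⟩⟨φₖ|` the series of products of amplitudes converges almost everywhere and in `L¹`,
and the `(a, b)` entry of `Tr_S(ρ)` is `ℓ⁻ⁿ ∑ₖ ⟨V_b φₖ, V_a φₖ⟩`, which is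
`ℓ⁻ⁿ Tr(V_b† V_a ρ)` and so does not depend on the ensemble (`tsum_inner_combAmplitude_eq`). The
matrix is a sum of transposed Gram matrices, hence positive semidefinite. Its diagonal entries are
`∑ₖ ⟨φₖ, K_a φₖ⟩ = Tr(K_a ρ)`, and they add up to `Tr ρ` because the `K_a` add up to the identity.
Ensembles exist: take `φᵢ = √ρ bᵢ` for an orthonormal basis `b` (`exists_isEnsemble`).
-/

/-! ### Traces and pure-state ensembles -/

/-- A series over the support of `v` may be reindexed along an injection of the support. -/
theorem hasSum_comp_extend_support {ι E G : Type*} [Zero E] [AddCommMonoid G] [TopologicalSpace G]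
    {v : ι → E} {g : Function.support v → ℕ} (hg : Function.Injective g) {F : E → G}
    (hF : F 0 = 0) {a : G} (ha : HasSum (fun i => F (v i)) a) :
    HasSum (fun k => F (Function.extend g (fun i : Function.support v => v i) 0 k)) a := by
  have h1 : (fun k => F (Function.extend g (fun i : Function.support v => v i) 0 k)) =
      Function.extend g (fun i : Function.support v => F (v i)) 0 := by
    funext k
    by_cases hk : ∃ i, g i = k
    · obtain ⟨i, rfl⟩ := hk
      rw [hg.extend_apply, hg.extend_apply]
    · rw [Function.extend_apply' _ _ _ hk, Function.extend_apply' _ _ _ hk]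
      exact hF
  rw [h1, hasSum_extend_zero hg]
  refine (hasSum_subtype_iff_of_support_subset (s := Function.support v) fun i hi => ?_).mpr ha
  intro h'
  exact hi (by simp only [h', hF])

section HilbertSpace

variable {E : Type*} [NormedAddCommGroup E] [InnerProductSpace ℂ E]

theorem summable_inner_map_self {φ : ℕ → E} (h : Summable fun k => ‖φ k‖ ^ 2) (T : E →L[ℂ] E) :
    Summable fun k => inner ℂ (φ k) (T (φ k)) := by
  refine Summable.of_norm_bounded (h.mul_left ‖T‖) fun k => ?_
  calc ‖inner ℂ (φ k) (T (φ k))‖ ≤ ‖φ k‖ * ‖T (φ k)‖ := norm_inner_le_norm _ _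
    _ ≤ ‖φ k‖ * (‖T‖ * ‖φ k‖) := by gcongr; exact T.le_opNorm _
    _ = ‖T‖ * ‖φ k‖ ^ 2 := by ring

/-- If `ρ = ∑ₖ |φₖ⟩⟨φₖ|` with `∑ₖ ‖φₖ‖² < ∞`, then the trace of `T ρ` is `∑ₖ ⟨φₖ, T φₖ⟩`: the
double series `∑ₖ ∑ᵢ ⟨φₖ, bᵢ⟩ ⟨bᵢ, T φₖ⟩` converges absolutely by Bessel's inequality, and its two
iterated sums are the two sides. -/
theorem HilbertBasis.hasSum_inner_comp_of_ensemble {κ : Type*} (b : HilbertBasis κ ℂ E)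
    {φ : ℕ → E} {ρ : E →L[ℂ] E} (h : Summable fun k => ‖φ k‖ ^ 2)
    (hρ : ∀ ψ, HasSum (fun k => inner ℂ (φ k) ψ • φ k) (ρ ψ)) (T : E →L[ℂ] E) :
    HasSum (fun i => inner ℂ (b i) (T (ρ (b i)))) (∑' k, inner ℂ (φ k) (T (φ k))) := by
  have hs := summable_inner_map_self h T
  set f : ℕ × κ → ℂ := fun p => inner ℂ (φ p.1) (b p.2) * inner ℂ (b p.2) (T (φ p.1)) with hf
  have hrow (k : ℕ) : HasSum (fun i => f (k, i)) (inner ℂ (φ k) (T (φ k))) :=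
    b.hasSum_inner_mul_inner (φ k) (T (φ k))
  have hsum : Summable f := by
    rw [← summable_norm_iff, summable_prod_of_nonneg (fun _ => norm_nonneg _)]
    refine ⟨fun k => (hrow k).summable.norm,
      Summable.of_nonneg_of_le (fun k => tsum_nonneg fun i => norm_nonneg _) (fun k => ?_)
        (h.mul_left (1 + ‖T‖ ^ 2))⟩
    have hb := b.orthonormal
    have h1 := hb.inner_products_summable (φ k)
    have h2 := hb.inner_products_summable (T (φ k))
    calc ∑' i, ‖f (k, i)‖
        ≤ ∑' i, (‖inner ℂ (b i) (φ k)‖ ^ 2 + ‖inner ℂ (b i) (T (φ k))‖ ^ 2) := by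
          refine (hrow k).summable.norm.tsum_le_tsum (fun i => ?_) (h1.add h2)
          rw [hf, norm_mul, norm_inner_symm (φ k) (b i)]
          nlinarith [sq_nonneg (‖inner ℂ (b i) (φ k)‖ - ‖inner ℂ (b i) (T (φ k))‖),
            sq_nonneg ‖inner ℂ (b i) (φ k)‖, sq_nonneg ‖inner ℂ (b i) (T (φ k))‖]
      _ = ∑' i, ‖inner ℂ (b i) (φ k)‖ ^ 2 + ∑' i, ‖inner ℂ (b i) (T (φ k))‖ ^ 2 :=
          h1.tsum_add h2
      _ ≤ ‖φ k‖ ^ 2 + ‖T (φ k)‖ ^ 2 :=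
          add_le_add (hb.tsum_inner_products_le _) (hb.tsum_inner_products_le _)
      _ ≤ ‖φ k‖ ^ 2 + (‖T‖ * ‖φ k‖) ^ 2 := by gcongr; exact T.le_opNorm _
      _ = (1 + ‖T‖ ^ 2) * ‖φ k‖ ^ 2 := by ring
  have htot : ∑' p, f p = ∑' k, inner ℂ (φ k) (T (φ k)) :=
    (hsum.hasSum.prod_fiberwise hrow).unique hs.hasSum
  have hswap : HasSum (fun p : κ × ℕ => f (p.2, p.1)) (∑' k, inner ℂ (φ k) (T (φ k))) := by
    rw [← htot]
    exact (Equiv.prodComm κ ℕ).hasSum_iff.mpr hsum.hasSum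
  refine hswap.prod_fiberwise fun i => ?_
  have := ((hρ (b i)).mapL T).mapL (innerSL ℂ (b i))
  simpa only [Function.comp_def, map_smul, innerSL_apply_apply, inner_smul_right, smul_eq_mul,
    hf] using this

/-- If the positive operator `ρ` has finite trace in an orthonormal basis `b`, then
`ρ = ∑ₖ |φₖ⟩⟨φₖ|` for the vectors `√ρ bᵢ`. All but countably many of them vanish, so that they can
be indexed by `ℕ`. -/
theorem HilbertBasis.exists_ensemble [CompleteSpace E] {κ : Type*} (b : HilbertBasis κ ℂ E)
    {ρ : E →L[ℂ] E}
    (hρ : ρ.IsPositive) (hc : Summable fun i => inner ℂ (b i) (ρ (b i))) :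
    ∃ φ : ℕ → E, (Summable fun k => ‖φ k‖ ^ 2) ∧
      ∀ ψ, HasSum (fun k => inner ℂ (φ k) ψ • φ k) (ρ ψ) := by
  have h0 : 0 ≤ ρ := (ContinuousLinearMap.nonneg_iff_isPositive ρ).mpr hρ
  set R : E →L[ℂ] E := CFC.sqrt ρ with hR
  have hRR (ψ : E) : R (R ψ) = ρ ψ :=
    congrArg (fun S : E →L[ℂ] E => S ψ) (CFC.sqrt_mul_sqrt_self ρ h0)
  have hsym (x y : E) : inner ℂ (R x) y = inner ℂ x (R y) :=
    ((ContinuousLinearMap.nonneg_iff_isPositive R).mp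
      (CFC.sqrt_nonneg ρ)).isSelfAdjoint.isSymmetric x y
  have hnorm : Summable fun i => ‖R (b i)‖ ^ 2 := by
    rw [← Complex.summable_ofReal]
    refine hc.congr fun i => ?_
    rw [← hRR, ← hsym, inner_self_eq_norm_sq_to_K]
    norm_cast
  have hcount : (Function.support fun i => R (b i)).Countable :=
    hnorm.countable_support.mono fun i hi => by simpa using hi
  set S := Function.support fun i => R (b i) with hS
  have := hcount.to_subtype
  obtain ⟨g, hg⟩ := exists_injective_nat S
  set φ : ℕ → E := Function.extend g (fun i : S => R (b i)) 0 with hφ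
  refine ⟨φ, (hasSum_comp_extend_support hg (F := fun x => ‖x‖ ^ 2) (by simp)
    hnorm.hasSum).summable, fun ψ => ?_⟩
  refine hasSum_comp_extend_support hg (F := fun x => inner ℂ x ψ • x) (by simp) ?_
  have := (b.hasSum_repr (R ψ)).mapL R
  simpa [hRR, hsym, b.repr_apply_apply] using this

end HilbertSpace

/-- For an ensemble `φ` of `ρ`, the trace of `T ρ` is `∑ₖ ⟨φₖ, T φₖ⟩`. -/
theorem IsEnsemble.exists_hasTrace {n : ℕ} {ρ : CVSpace n →L[ℂ] CVSpace n} {φ : ℕ → CVSpace n}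
    (h : IsEnsemble ρ φ) (T : CVSpace n →L[ℂ] CVSpace n) :
    ∃ c : ℂ, HasSum (fun k => inner ℂ (φ k) (T (φ k))) c ∧ HasTrace (T ∘L ρ) c :=
  ⟨_, (summable_inner_map_self h.1 T).hasSum,
    fun _ b => b.hasSum_inner_comp_of_ensemble h.1 h.2 T⟩

/-- The trace of an operator is unique, since `L²(ℝⁿ)` has an orthonormal basis. -/
theorem HasTrace.unique {n : ℕ} {T : CVSpace n →L[ℂ] CVSpace n} {c c' : ℂ}
    (h : HasTrace T c) (h' : HasTrace T c') : c = c' := by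
  obtain ⟨w, b, -⟩ := exists_hilbertBasis ℂ (CVSpace n)
  exact (h w b).unique (h' w b)

/-- In an ensemble for `ρ`, the weights `‖φₖ‖²` add up to the trace of `ρ`. -/
theorem IsEnsemble.hasSum_norm_sq {n : ℕ} {ρ : CVSpace n →L[ℂ] CVSpace n} {φ : ℕ → CVSpace n}
    (h : IsEnsemble ρ φ) {c : ℂ} (hc : HasTrace ρ c) :
    HasSum (fun k => inner ℂ (φ k) (φ k)) c := by
  obtain ⟨c', hs, ht⟩ := h.exists_hasTrace (ContinuousLinearMap.id ℂ (CVSpace n))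
  rw [ContinuousLinearMap.id_comp] at ht
  rw [hc.unique ht]
  simpa using hs

theorem exists_isEnsemble {n : ℕ} {ρ : CVSpace n →L[ℂ] CVSpace n} (hρ : ρ.IsPositive) {c : ℂ}
    (hc : HasTrace ρ c) : ∃ φ : ℕ → CVSpace n, IsEnsemble ρ φ := by
  obtain ⟨w, b, -⟩ := exists_hilbertBasis ℂ (CVSpace n)
  exact b.exists_ensemble hρ (hc w b).summable

/-! ### Projections onto sets of positions -/

theorem coeFn_positionProj {n : ℕ} {S : Set (Fin n → ℝ)} (hS : MeasurableSet S) (ψ : CVSpace n) :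
    positionProj S hS ψ =ᵐ[volume] S.indicator ψ :=
  ((Lp.memLp ψ).indicator hS).coeFn_toLp

theorem inner_positionProj {n : ℕ} {S : Set (Fin n → ℝ)} (hS : MeasurableSet S)
    (ψ φ : CVSpace n) :
    inner ℂ ψ (positionProj S hS φ) = ∫ x in S, inner ℂ (ψ x) (φ x) := by
  rw [L2.inner_def, ← integral_indicator hS]
  refine integral_congr_ae ?_
  filter_upwards [coeFn_positionProj hS φ] with x hx
  rw [hx]
  by_cases h : x ∈ S <;> simp [h]

theorem positionProj_univ {n : ℕ} (ψ : CVSpace n) :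
    positionProj Set.univ MeasurableSet.univ ψ = ψ := by
  refine Lp.ext ?_
  filter_upwards [coeFn_positionProj MeasurableSet.univ ψ] with x hx
  simpa using hx

theorem positionProj_congr {n : ℕ} {S T : Set (Fin n → ℝ)} (hS : MeasurableSet S)
    (hT : MeasurableSet T) (h : S = T) : positionProj S hS = positionProj T hT := by
  subst h; rfl

theorem inner_positionProj_positionProj {n : ℕ} {S T : Set (Fin n → ℝ)} (hS : MeasurableSet S)
    (hT : MeasurableSet T) (ψ φ : CVSpace n) :
    inner ℂ (positionProj S hS ψ) (positionProj T hT φ) =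
      ∫ x in S ∩ T, inner ℂ (ψ x) (φ x) := by
  rw [inner_positionProj hT, Set.inter_comm, ← setIntegral_indicator hS]
  refine integral_congr_ae ?_
  filter_upwards [ae_restrict_of_ae (coeFn_positionProj hS ψ)] with x hx
  rw [hx]
  by_cases h : x ∈ S <;> simp [h]

/-- A family of vectors in pairwise orthogonal ranges is summable as soon as its squared norms
are. -/
theorem summable_of_pairwise_inner_eq_zero {ι E F : Type*} [NormedAddCommGroup E]
    [InnerProductSpace ℂ E] [NormedAddCommGroup F] [InnerProductSpace ℂ F] [CompleteSpace F]
    (T : ι → E →L[ℂ] F) (hT : ∀ i j, i ≠ j → ∀ x y, inner ℂ (T i x) (T j y) = 0) {x : E}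
    (hx : Summable fun i => ‖T i x‖ ^ 2) : Summable fun i => T i x := by
  have hV : OrthogonalFamily ℂ (fun i => (T i).range)
      fun i => ((T i).range).subtypeₗᵢ := by
    rintro i j hij ⟨_, u, rfl⟩ ⟨_, v, rfl⟩
    exact hT i j hij u v
  exact (hV.summable_iff_norm_sq_summable fun i => ⟨T i x, x, rfl⟩).mpr hx

/-- Projections onto positions are strongly countably additive. -/
theorem hasSum_positionProj_iUnion {n : ℕ} {ι : Type*} [Countable ι] {B : ι → Set (Fin n → ℝ)}
    (hB : ∀ i, MeasurableSet (B i)) (hd : Pairwise (Function.onFun Disjoint B)) (ψ : CVSpace n) :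
    HasSum (fun i => positionProj (B i) (hB i) ψ)
      (positionProj (⋃ i, B i) (MeasurableSet.iUnion hB) ψ) := by
  have hweak (χ : CVSpace n) : HasSum (fun i => inner ℂ χ (positionProj (B i) (hB i) ψ))
      (inner ℂ χ (positionProj (⋃ i, B i) (MeasurableSet.iUnion hB) ψ)) := by
    simp only [inner_positionProj]
    exact hasSum_integral_iUnion hB hd (L2.integrable_inner χ ψ).integrableOn
  have hs : Summable fun i => positionProj (B i) (hB i) ψ := by
    refine summable_of_pairwise_inner_eq_zero (fun i => positionProj (B i) (hB i)) ?_ ?_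
    · intro i j hij x y
      rw [inner_positionProj_positionProj, (hd hij).inter_eq]
      simp
    · rw [← Complex.summable_ofReal]
      refine (hweak ψ).summable.congr fun i => ?_
      have : inner ℂ (positionProj (B i) (hB i) ψ) (positionProj (B i) (hB i) ψ) =
          inner ℂ ψ (positionProj (B i) (hB i) ψ) := by
        rw [inner_positionProj_positionProj, Set.inter_self, inner_positionProj]
      rw [← this, inner_self_eq_norm_sq_to_K]
      norm_cast
  convert hs.hasSum using 1
  refine ext_inner_left ℂ fun χ => (hweak χ).unique ?_
  exact hs.hasSum.mapL (innerSL ℂ χ)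

/-! ### Translations -/

theorem coeFn_translation {n : ℕ} (s : Fin n → ℝ) (ψ : CVSpace n) :
    translation s ψ =ᵐ[volume] fun y => ψ (y - s) :=
  Lp.coeFn_compMeasurePreserving ψ (measurePreserving_sub_right volume s)

theorem ae_comp_sub {n : ℕ} (s : Fin n → ℝ) {p : (Fin n → ℝ) → Prop} (h : ∀ᵐ x, p x) :
    ∀ᵐ x, p (x - s) :=
  (measurePreserving_sub_right volume s).quasiMeasurePreserving.ae h

theorem translation_translation_neg {n : ℕ} (s : Fin n → ℝ) (ψ : CVSpace n) :
    translation s (translation (-s) ψ) = ψ := by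
  refine Lp.ext ?_
  filter_upwards [coeFn_translation s (translation (-s) ψ),
    ae_comp_sub s (coeFn_translation (-s) ψ)] with x h1 h2
  rw [h1, h2, sub_neg_eq_add, sub_add_cancel]

theorem adjoint_translation {n : ℕ} (s : Fin n → ℝ) (ψ : CVSpace n) :
    ContinuousLinearMap.adjoint (translation s) ψ = translation (-s) ψ := by
  have h : ContinuousLinearMap.adjoint (translation s) (translation s (translation (-s) ψ)) =
      translation (-s) ψ := by
    refine ext_inner_left ℂ fun χ => ?_
    rw [ContinuousLinearMap.adjoint_inner_right]
    exact LinearIsometry.inner_map_map _ _ _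
  rwa [translation_translation_neg] at h

/-- Conjugating the projection onto the bin at `x` by a translation gives the translated bin. -/
theorem translation_binOperator_adjoint {n : ℕ} (d : ℕ) (x s : Fin n → ℝ) (ψ : CVSpace n) :
    translation s (binOperator d x (ContinuousLinearMap.adjoint (translation s) ψ)) =
      binOperator d (x + s) ψ := by
  rw [adjoint_translation]
  refine Lp.ext ?_
  filter_upwards [coeFn_translation s (binOperator d x (translation (-s) ψ)),
    ae_comp_sub s (coeFn_positionProj (measurableSet_bin d x) (translation (-s) ψ)),
    ae_comp_sub s (coeFn_translation (-s) ψ),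
    coeFn_positionProj (measurableSet_bin d (x + s)) ψ] with y h1 h2 h3 h4
  rw [h1, binOperator, h2, binOperator, h4]
  have hmem : y - s ∈ bin d x ↔ y ∈ bin d (x + s) := by
    simp only [bin, Set.mem_preimage, sub_sub, add_comm]
  by_cases h : y ∈ bin d (x + s)
  · rw [Set.indicator_of_mem h, Set.indicator_of_mem (hmem.mpr h), h3, sub_neg_eq_add,
      sub_add_cancel]
  · rw [Set.indicator_of_notMem h, Set.indicator_of_notMem (mt hmem.mp h)]

/-! ### The tiling of position space by bins -/

theorem gridSpacing_pos {d : ℕ} (hd : 0 < d) : 0 < gridSpacing d := by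
  have : (0 : ℝ) < d := by exact_mod_cast hd
  exact Real.sqrt_pos.mpr (by positivity)

/-- The defining relation `ℓ² d = 2π` of the lattice spacing. -/
theorem gridSpacing_mul_self {d : ℕ} (hd : 0 < d) :
    gridSpacing d * gridSpacing d * d = 2 * Real.pi := by
  have : (0 : ℝ) < d := by exact_mod_cast hd
  rw [gridSpacing, Real.mul_self_sqrt (by positivity)]
  field_simp

/-- A point lies in the bin at the lattice point `ℓ z` exactly when `z` is obtained by rounding its
coordinates, divided by `ℓ`, to the nearest integer (and downwards from the midpoints). -/
theorem mem_bin_grid_iff {n d : ℕ} (hd : 0 < d) (z : Fin n → ℤ) (y : Fin n → ℝ) :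
    y ∈ bin d (fun j => gridSpacing d * z j) ↔ ∀ j, ⌈y j / gridSpacing d - 1 / 2⌉ = z j := by
  have hl := gridSpacing_pos hd
  simp only [bin, cube, Set.mem_preimage, Set.mem_univ_pi, Set.mem_Ioc, Pi.sub_apply]
  refine forall_congr' fun j => ?_
  rw [Int.ceil_eq_iff]
  have hy : y j = gridSpacing d * (y j / gridSpacing d) := by field_simp
  generalize y j / gridSpacing d = u at hy
  rw [hy]
  constructor
  · rintro ⟨h1, h2⟩
    exact ⟨by nlinarith, by nlinarith⟩
  · rintro ⟨h1, h2⟩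
    exact ⟨by nlinarith, by nlinarith⟩

theorem combPoint_eq {n d : ℕ} (a : Fin n → Fin d) (m : Fin n → ℤ) :
    combPoint a m = fun j => gridSpacing d * ((d * m j + (a j : ℕ) : ℤ) : ℝ) := by
  funext j
  simp [combPoint]

theorem mem_bin_combPoint_iff {n d : ℕ} (hd : 0 < d) (a : Fin n → Fin d) (m : Fin n → ℤ)
    (y : Fin n → ℝ) : y ∈ bin d (combPoint a m) ↔
      ∀ j, ⌈y j / gridSpacing d - 1 / 2⌉ = d * m j + (a j : ℕ) := by
  rw [combPoint_eq]
  exact mem_bin_grid_iff hd _ y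

/-- The union of the bins at the teeth of the comb `|a_GKP⟩`, that is, the set of positions whose
nearest point of the lattice `ℓ ℤⁿ` is a tooth of this comb. -/
def combCell {n d : ℕ} (a : Fin n → Fin d) : Set (Fin n → ℝ) :=
  ⋃ m : Fin n → ℤ, bin d (combPoint a m)

theorem measurableSet_combCell {n d : ℕ} (a : Fin n → Fin d) : MeasurableSet (combCell a) :=
  MeasurableSet.iUnion fun _ => measurableSet_bin _ _

theorem pairwise_disjoint_bin_combPoint {n d : ℕ} (hd : 0 < d) (a : Fin n → Fin d) :
    Pairwise (Function.onFun Disjoint fun m => bin d (combPoint a m)) := by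
  intro m m' hne
  refine Set.disjoint_left.mpr fun y h h' => hne (funext fun j => ?_)
  rw [mem_bin_combPoint_iff hd] at h h'
  have hd' : (d : ℤ) ≠ 0 := by exact_mod_cast hd.ne'
  exact mul_left_cancel₀ hd' (by linarith [h j, h' j])

theorem mem_combCell_iff {n d : ℕ} (hd : 0 < d) (a : Fin n → Fin d) (y : Fin n → ℝ) :
    y ∈ combCell a ↔ ∀ j, ⌈y j / gridSpacing d - 1 / 2⌉ % (d : ℤ) = (a j : ℕ) := by
  have hd' : (0 : ℤ) < d := by exact_mod_cast hd
  simp only [combCell, Set.mem_iUnion, mem_bin_combPoint_iff hd]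
  constructor
  · rintro ⟨m, hm⟩ j
    rw [hm j, Int.mul_add_emod_self_left]
    exact Int.emod_eq_of_lt (by positivity) (by exact_mod_cast (a j).isLt)
  · intro h
    refine ⟨fun j => ⌈y j / gridSpacing d - 1 / 2⌉ / (d : ℤ), fun j => ?_⟩
    rw [← h j, Int.mul_ediv_add_emod]

theorem pairwise_disjoint_combCell {n d : ℕ} (hd : 0 < d) :
    Pairwise (Function.onFun Disjoint fun a : Fin n → Fin d => combCell a) := by
  intro a b hne
  refine Set.disjoint_left.mpr fun y h h' => hne (funext fun j => Fin.ext ?_)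
  rw [mem_combCell_iff hd] at h h'
  exact_mod_cast (h j).symm.trans (h' j)

theorem iUnion_combCell {n d : ℕ} (hd : 0 < d) :
    ⋃ a : Fin n → Fin d, combCell a = Set.univ := by
  refine Set.eq_univ_of_forall fun y => Set.mem_iUnion.mpr ?_
  have hd' : (0 : ℤ) < d := by exact_mod_cast hd
  have h0 (j : Fin n) := Int.emod_nonneg ⌈y j / gridSpacing d - 1 / 2⌉ hd'.ne'
  have h1 (j : Fin n) := Int.emod_lt_of_pos ⌈y j / gridSpacing d - 1 / 2⌉ hd'
  refine ⟨fun j => ⟨(⌈y j / gridSpacing d - 1 / 2⌉ % (d : ℤ)).toNat, by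
    have := h0 j; have := h1 j; omega⟩, (mem_combCell_iff hd _ y).mpr fun j => ?_⟩
  exact (Int.toNat_of_nonneg (h0 j)).symm

/-- The projection `K_a` onto the positions nearest to the comb `|a_GKP⟩`. -/
noncomputable def combProj {n d : ℕ} (a : Fin n → Fin d) : CVSpace n →L[ℂ] CVSpace n :=
  positionProj (combCell a) (measurableSet_combCell a)

theorem hasSum_binOperator_combPoint {n d : ℕ} (hd : 0 < d) (a : Fin n → Fin d) (ψ : CVSpace n) :
    HasSum (fun m => binOperator d (combPoint a m) ψ) (combProj a ψ) :=
  hasSum_positionProj_iUnion (fun m => measurableSet_bin d (combPoint a m))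
    (pairwise_disjoint_bin_combPoint hd a) ψ

theorem sum_combProj {n d : ℕ} (hd : 0 < d) (ψ : CVSpace n) :
    ∑ a : Fin n → Fin d, combProj a ψ = ψ := by
  have h := hasSum_positionProj_iUnion (fun a : Fin n → Fin d => measurableSet_combCell a)
    (pairwise_disjoint_combCell hd) ψ
  rw [positionProj_congr _ MeasurableSet.univ (iUnion_combCell hd), positionProj_univ] at h
  exact (hasSum_fintype _).unique h

/-! ### Measurement outcomes and modular measurement operators -/

/-- The centred residue of `a` differs from `a` by a multiple of `d`. -/
theorem exists_centredResidue_eq (d : ℕ) (a : Fin d) :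
    ∃ w : ℤ, centredResidue d a = (a : ℕ) + d * w := by
  refine ⟨-(((a : ℕ) + d / 2) / d : ℕ), ?_⟩
  have h := Nat.div_add_mod ((a : ℕ) + d / 2) d
  have h' : (d : ℤ) * (((a : ℕ) + d / 2) / d : ℕ) + (((a : ℕ) + d / 2) % d : ℕ) =
    (a : ℕ) + (d / 2 : ℕ) := by exact_mod_cast h
  rw [centredResidue]
  linarith

theorem bijOn_outcomeOf {n d : ℕ} (hd : 0 < d) :
    Set.BijOn (outcomeOf : (Fin n → Fin d) → (Fin n → ℝ)) Set.univ (outcomes n d) := by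
  have hl := (gridSpacing_pos hd).ne'
  have hval (a : Fin d) : (centredResidue d a : ℝ) =
      ((((a : ℕ) + d / 2) % d : ℕ) : ℝ) - ((d / 2 : ℕ) : ℝ) := by
    rw [centredResidue, Int.cast_sub, Int.cast_natCast, Int.cast_natCast]
  refine ⟨fun a _ j => ⟨⟨((a j : ℕ) + d / 2) % d, Nat.mod_lt _ hd⟩, ?_⟩, ?_, ?_⟩
  · simp only [outcomeOf, hval]
  · intro a _ b _ h
    funext j
    have hj := mul_left_cancel₀ hl (congrFun h j)
    rw [hval, hval, sub_left_inj, Nat.cast_inj] at hj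
    exact Fin.ext (Nat.ModEq.eq_of_lt_of_lt (Nat.ModEq.add_right_cancel' _ hj) (a j).isLt
      (b j).isLt)
  · intro x hx
    choose u hu using hx
    -- The residue of `u - ⌊d/2⌋` modulo `d`, written without a truncated subtraction.
    refine ⟨fun j => ⟨((u j : ℕ) + (d - d / 2)) % d, Nat.mod_lt _ hd⟩, trivial, ?_⟩
    funext j
    have h : ((((u j : ℕ) + (d - d / 2)) % d + d / 2) % d) = u j := by
      rw [Nat.mod_add_mod, show (u j : ℕ) + (d - d / 2) + d / 2 = u j + d by omega,
        Nat.add_mod_right, Nat.mod_eq_of_lt (u j).isLt]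
    rw [hu j, outcomeOf, hval]
    simp only [h]

/-- The modular measurement operator at the outcome of `a` is the projection onto the positions
nearest to the comb `|a_GKP⟩`: the translated bins are the bins at the teeth of the comb, up to a
shift of the index `m`. -/
theorem isModularBinOperator_combProj {n d : ℕ} (hd : 0 < d) (a : Fin n → Fin d) :
    IsModularBinOperator d (outcomeOf a) (combProj a) := by
  intro ψ
  choose w hw using exists_centredResidue_eq d
  have h := (Equiv.addRight fun j => w (a j)).hasSum_iff.mpr
    (hasSum_binOperator_combPoint hd a ψ)
  convert h using 1
  funext m
  rw [Function.comp_apply, translation_binOperator_adjoint]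
  congr 2
  funext j
  simp only [outcomeOf, hw, combPoint, Pi.add_apply, Equiv.coe_addRight]
  push_cast
  ring

/-! ### The amplitudes of the combs -/

/-- The Hilbert space `L²(𝕋_ℓ²ⁿ)` of square-integrable functions on the phase-space cell. -/
abbrev CellSpace (n d : ℕ) : Type := Lp ℂ 2 (volume.restrict (phaseCell n d))

instance isFiniteMeasure_restrict_cube (n d : ℕ) :
    IsFiniteMeasure (volume.restrict (cube n d)) := by
  refine ⟨?_⟩
  rw [Measure.restrict_apply_univ, cube, volume_pi_pi]
  exact ENNReal.prod_lt_top fun _ _ => measure_Ioc_lt_top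

theorem restrict_phaseCell (n d : ℕ) :
    (volume : Measure ((Fin n → ℝ) × (Fin n → ℝ))).restrict (phaseCell n d) =
      (volume.restrict (cube n d)).prod (volume.restrict (cube n d)) :=
  (Measure.prod_restrict _ _).symm

theorem ae_phaseCell_of_ae {n d : ℕ} (c : Fin n → ℝ) {p : (Fin n → ℝ) → Prop}
    (h : ∀ᵐ x, p x) : ∀ᵐ t ∂(volume.restrict (phaseCell n d)), p (c + t.1) := by
  have h1 : ∀ᵐ x : Fin n → ℝ, p (c + x) :=
    (measurePreserving_add_left volume c).quasiMeasurePreserving.ae h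
  rw [restrict_phaseCell]
  exact Measure.quasiMeasurePreserving_fst.ae (ae_restrict_of_ae (s := cube n d) h1)

theorem memLp_displacement {n d : ℕ} (c : Fin n → ℝ) (ψ : CVSpace n) :
    MemLp (fun t => displacement t ψ c) 2 (volume.restrict (phaseCell n d)) := by
  have h1 : MemLp (fun x => ψ (c + x)) 2 (volume.restrict (cube n d)) :=
    ((Lp.memLp ψ).comp_measurePreserving (measurePreserving_add_left volume c)).restrict _
  have h2 : MemLp (fun t : (Fin n → ℝ) × (Fin n → ℝ) => ψ (c + t.1)) 2
      (volume.restrict (phaseCell n d)) := by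
    rw [restrict_phaseCell]
    exact h1.comp_fst _
  refine h2.congr_norm (AEStronglyMeasurable.mul ?_ h2.1) (Eventually.of_forall fun t => ?_)
  · refine Continuous.aestronglyMeasurable ?_
    fun_prop
  · rw [displacement, norm_mul, neg_mul, ← mul_neg, ← Complex.ofReal_neg,
      Complex.norm_exp_I_mul_ofReal, one_mul]

/-- The summand `t ↦ (D(t)ψ)(c)` of the comb amplitudes, for a single tooth at `c`. -/
noncomputable def toothLinearMap {n : ℕ} (d : ℕ) (c : Fin n → ℝ) :
    CVSpace n →ₗ[ℂ] CellSpace n d where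
  toFun ψ := (memLp_displacement c ψ).toLp
  map_add' ψ φ := by
    rw [← MemLp.toLp_add, MemLp.toLp_eq_toLp_iff]
    filter_upwards [ae_phaseCell_of_ae c (Lp.coeFn_add ψ φ)] with t ht
    simp only [displacement, ht, Pi.add_apply, mul_add]
  map_smul' z ψ := by
    rw [RingHom.id_apply, ← MemLp.toLp_const_smul, MemLp.toLp_eq_toLp_iff]
    filter_upwards [ae_phaseCell_of_ae c (Lp.coeFn_smul z ψ)] with t ht
    simp only [displacement, ht, Pi.smul_apply, smul_eq_mul]
    ring

theorem coeFn_toothLinearMap {n d : ℕ} (c : Fin n → ℝ) (ψ : CVSpace n) :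
    toothLinearMap d c ψ =ᵐ[volume.restrict (phaseCell n d)] fun t => displacement t ψ c :=
  (memLp_displacement c ψ).coeFn_toLp

/-- The half phase `t_p·t_q/2` of the displacement cancels, and the integral over the cell
factorizes into a position and a momentum integral. -/
theorem inner_toothLinearMap {n d : ℕ} (c c' : Fin n → ℝ) (ψ φ : CVSpace n) :
    inner ℂ (toothLinearMap d c ψ) (toothLinearMap d c' φ) =
      (∫ x in cube n d, inner ℂ (ψ (c + x)) (φ (c' + x))) *
        ∫ s in cube n d, Complex.exp (Complex.I * ((∑ j, s j * (c j - c' j) : ℝ) : ℂ)) := by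
  rw [L2.inner_def, ← setIntegral_prod_mul]
  refine integral_congr_ae ?_
  filter_upwards [coeFn_toothLinearMap c ψ, coeFn_toothLinearMap c' φ] with t h1 h2
  rw [h1, h2, displacement, displacement, RCLike.inner_apply, RCLike.inner_apply, map_mul,
    ← Complex.exp_conj]
  have h : Complex.exp (Complex.I * ((∑ j, t.2 j * (c j - c' j) : ℝ) : ℂ)) =
      Complex.exp (-Complex.I * ((∑ j, t.2 j * c' j + (∑ j, t.2 j * t.1 j) / 2 : ℝ) : ℂ)) *
      Complex.exp ((starRingEnd ℂ)
        (-Complex.I * ((∑ j, t.2 j * c j + (∑ j, t.2 j * t.1 j) / 2 : ℝ) : ℂ))) := by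
    rw [← Complex.exp_add, map_mul, map_neg, Complex.conj_I, Complex.conj_ofReal]
    congr 1
    simp only [mul_sub, Finset.sum_sub_distrib]
    push_cast
    ring
  rw [h]
  ring

/-- Orthogonality of the characters of the momentum cell, in one dimension: as `ℓ² d = 2π`, the
functions `s ↦ exp(i s ℓ d k)` have period `ℓ / k`. -/
theorem integral_exp_grid {d : ℕ} (hd : 0 < d) (k : ℤ) :
    ∫ s in Set.Ioc (-(gridSpacing d) / 2) (gridSpacing d / 2),
      Complex.exp (Complex.I * ((s * (gridSpacing d * d * k) : ℝ) : ℂ)) =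
        if k = 0 then (gridSpacing d : ℂ) else 0 := by
  have hl := gridSpacing_pos hd
  have hle : -(gridSpacing d) / 2 ≤ gridSpacing d / 2 := by linarith
  split_ifs with hk
  · subst hk
    simp only [Int.cast_zero, mul_zero, Complex.ofReal_zero, Complex.exp_zero]
    rw [setIntegral_const, Real.volume_real_Ioc_of_le hle, Complex.real_smul, mul_one]
    congr 1
    ring
  · rw [← intervalIntegral.integral_of_le hle]
    have hc : Complex.I * ((gridSpacing d * d * k : ℝ) : ℂ) ≠ 0 := by
      have : (d : ℝ) ≠ 0 := by exact_mod_cast hd.ne'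
      have : (k : ℝ) ≠ 0 := by exact_mod_cast hk
      refine mul_ne_zero Complex.I_ne_zero (Complex.ofReal_ne_zero.mpr ?_)
      have := hl.ne'
      positivity
    have h := integral_exp_mul_complex (a := -(gridSpacing d) / 2) (b := gridSpacing d / 2) hc
    have he : Complex.exp (Complex.I * ((gridSpacing d * d * k : ℝ) : ℂ) *
          ((gridSpacing d / 2 : ℝ) : ℂ)) =
        Complex.exp (Complex.I * ((gridSpacing d * d * k : ℝ) : ℂ) *
          ((-(gridSpacing d) / 2 : ℝ) : ℂ)) := by
      refine Complex.exp_eq_exp_iff_exists_int.mpr ⟨k, ?_⟩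
      have h2 : (gridSpacing d * gridSpacing d * d : ℂ) = 2 * Real.pi := by
        exact_mod_cast gridSpacing_mul_self hd
      push_cast
      linear_combination Complex.I * k * h2
    rw [he, sub_self, zero_div] at h
    rw [← h]
    congr 1
    funext s
    push_cast
    ring_nf

theorem integral_exp_cube {n d : ℕ} (hd : 0 < d) (k : Fin n → ℤ) :
    ∫ s in cube n d,
      Complex.exp (Complex.I * ((∑ j, s j * (gridSpacing d * d * k j) : ℝ) : ℂ)) =
        if k = 0 then (gridSpacing d : ℂ) ^ n else 0 := by
  rw [cube, volume_pi, Measure.restrict_pi_pi]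
  simp only [Complex.ofReal_sum, Finset.mul_sum, Complex.exp_sum]
  rw [integral_fintype_prod_eq_prod (𝕜 := ℂ) (f := fun j (s : ℝ) =>
    Complex.exp (Complex.I * ((s * (gridSpacing d * d * k j) : ℝ) : ℂ)))]
  simp only [integral_exp_grid hd]
  split_ifs with h
  · simp [h]
  · obtain ⟨j, hj⟩ := Function.ne_iff.mp h
    exact Finset.prod_eq_zero (Finset.mem_univ j) (if_neg hj)

theorem inner_toothLinearMap_combPoint {n d : ℕ} (hd : 0 < d) (a : Fin n → Fin d)
    (m m' : Fin n → ℤ) (ψ φ : CVSpace n) :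
    inner ℂ (toothLinearMap d (combPoint a m) ψ) (toothLinearMap d (combPoint a m') φ) =
      if m = m' then (gridSpacing d : ℂ) ^ n * inner ℂ ψ (binOperator d (combPoint a m) φ)
      else 0 := by
  have hdiff (j : Fin n) : combPoint a m j - combPoint a m' j =
      gridSpacing d * d * ((m - m') j : ℤ) := by
    simp only [combPoint, Pi.sub_apply]
    push_cast
    ring
  simp only [inner_toothLinearMap, hdiff, integral_exp_cube hd, sub_eq_zero]
  split_ifs with h
  · subst h
    rw [mul_comm, binOperator, inner_positionProj]
    congr 1
    have := (measurePreserving_sub_right (volume : Measure (Fin n → ℝ))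
      (combPoint a m)).setIntegral_preimage_emb (MeasurableEquiv.subRight _).measurableEmbedding
      (fun x => inner ℂ (ψ (combPoint a m + x)) (φ (combPoint a m + x))) (cube n d)
    simp only [add_sub_cancel] at this
    exact this.symm
  · rw [mul_zero]

theorem norm_sq_toothLinearMap {n d : ℕ} (hd : 0 < d) (a : Fin n → Fin d)
    (m : Fin n → ℤ) (ψ : CVSpace n) :
    ((‖toothLinearMap d (combPoint a m) ψ‖ ^ 2 : ℝ) : ℂ) =
      (gridSpacing d : ℂ) ^ n * inner ℂ ψ (binOperator d (combPoint a m) ψ) := by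
  have h := inner_toothLinearMap_combPoint hd a m m ψ ψ
  rw [if_pos rfl, inner_self_eq_norm_sq_to_K] at h
  rw [← h]
  norm_cast

theorem LinearMap.exists_bound_of_norm_sq_eq {E F : Type*} [NormedAddCommGroup E]
    [InnerProductSpace ℂ E] [NormedAddCommGroup F] [InnerProductSpace ℂ F] (T : E →ₗ[ℂ] F)
    (P : E →L[ℂ] E) (z : ℂ) (h : ∀ x, ((‖T x‖ ^ 2 : ℝ) : ℂ) = z * inner ℂ x (P x)) :
    ∃ C, ∀ x, ‖T x‖ ≤ C * ‖x‖ := by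
  refine ⟨Real.sqrt (‖z‖ * ‖P‖), fun x => ?_⟩
  rw [← pow_le_pow_iff_left₀ (norm_nonneg _) (by positivity) two_ne_zero, mul_pow,
    Real.sq_sqrt (by positivity)]
  calc ‖T x‖ ^ 2 = ‖((‖T x‖ ^ 2 : ℝ) : ℂ)‖ := by
        rw [Complex.norm_real, Real.norm_of_nonneg (by positivity)]
    _ = ‖z‖ * ‖inner ℂ x (P x)‖ := by rw [h, norm_mul]
    _ ≤ ‖z‖ * (‖x‖ * (‖P‖ * ‖x‖)) := by
        gcongr
        exact (norm_inner_le_norm _ _).trans (by gcongr; exact P.le_opNorm x)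
    _ = ‖z‖ * ‖P‖ * ‖x‖ ^ 2 := by ring

theorem hasSum_inner_binOperator {n d : ℕ} (hd : 0 < d) (a : Fin n → Fin d) (ψ φ : CVSpace n) :
    HasSum (fun m => inner ℂ ψ (binOperator d (combPoint a m) φ))
      (inner ℂ ψ (combProj a φ)) :=
  (hasSum_binOperator_combPoint hd a φ).mapL (innerSL ℂ ψ)

/-- The comb amplitude converges unconditionally in mean square: its summands are pairwise
orthogonal on the cell, with summable squared norms. -/
theorem summable_toothLinearMap {n d : ℕ} (hd : 0 < d) (a : Fin n → Fin d) (ψ : CVSpace n) :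
    Summable fun m => toothLinearMap d (combPoint a m) ψ := by
  have hb (m : Fin n → ℤ) := (toothLinearMap d (combPoint a m)).exists_bound_of_norm_sq_eq
    (binOperator d (combPoint a m)) _ (norm_sq_toothLinearMap hd a m)
  refine summable_of_pairwise_inner_eq_zero
    (fun m => (toothLinearMap d (combPoint a m)).mkContinuousOfExistsBound (hb m)) ?_ ?_
  · intro m m' hne x y
    exact (inner_toothLinearMap_combPoint hd a m m' x y).trans (if_neg hne)
  · rw [← Complex.summable_ofReal]
    refine ((hasSum_inner_binOperator hd a ψ ψ).summable.mul_left
      ((gridSpacing d : ℂ) ^ n)).congr fun m => ?_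
    exact (norm_sq_toothLinearMap hd a m ψ).symm

/-- The map `ψ ↦ ⟨a_GKP| D(·) |ψ⟩`, as a linear map; `combAmplitude` is its bounded version. -/
noncomputable def combAmplitudeLinearMap {n d : ℕ} (hd : 0 < d) (a : Fin n → Fin d) :
    CVSpace n →ₗ[ℂ] CellSpace n d where
  toFun ψ := ∑' m, toothLinearMap d (combPoint a m) ψ
  map_add' ψ φ := by
    simp only [map_add]
    exact (summable_toothLinearMap hd a ψ).tsum_add (summable_toothLinearMap hd a φ)
  map_smul' z ψ := by
    simp only [map_smul, RingHom.id_apply]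
    exact (summable_toothLinearMap hd a ψ).tsum_const_smul z

theorem hasSum_combAmplitudeLinearMap {n d : ℕ} (hd : 0 < d) (a : Fin n → Fin d)
    (ψ : CVSpace n) :
    HasSum (fun m => toothLinearMap d (combPoint a m) ψ) (combAmplitudeLinearMap hd a ψ) :=
  (summable_toothLinearMap hd a ψ).hasSum

theorem inner_combAmplitudeLinearMap {n d : ℕ} (hd : 0 < d) (a : Fin n → Fin d)
    (ψ φ : CVSpace n) :
    inner ℂ (combAmplitudeLinearMap hd a ψ) (combAmplitudeLinearMap hd a φ) =
      (gridSpacing d : ℂ) ^ n * inner ℂ ψ (combProj a φ) := by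
  have h1 (m : Fin n → ℤ) : inner ℂ (combAmplitudeLinearMap hd a ψ)
      (toothLinearMap d (combPoint a m) φ) =
      (gridSpacing d : ℂ) ^ n * inner ℂ ψ (binOperator d (combPoint a m) φ) := by
    have h := (hasSum_combAmplitudeLinearMap hd a ψ).map
      (innerSLFlip ℂ (toothLinearMap d (combPoint a m) φ)).toAddMonoidHom
      (innerSLFlip ℂ (toothLinearMap d (combPoint a m) φ)).continuous
    refine h.unique ?_
    rw [← (inner_toothLinearMap_combPoint hd a m m ψ φ).trans (if_pos rfl)]
    exact hasSum_single m fun m' hm' =>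
      (inner_toothLinearMap_combPoint hd a m' m ψ φ).trans (if_neg hm')
  have h2 := (hasSum_combAmplitudeLinearMap hd a φ).mapL
    (innerSL ℂ (combAmplitudeLinearMap hd a ψ))
  refine h2.unique ?_
  exact ((hasSum_inner_binOperator hd a ψ φ).mul_left _).congr_fun fun m => h1 m

/-- The bounded operator `V_a` that sends `ψ` to its comb amplitude `t ↦ ⟨a_GKP| D(t) |ψ⟩` on the
phase-space cell. -/
noncomputable def combAmplitude {n d : ℕ} (hd : 0 < d) (a : Fin n → Fin d) :
    CVSpace n →L[ℂ] CellSpace n d :=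
  (combAmplitudeLinearMap hd a).mkContinuousOfExistsBound <|
    (combAmplitudeLinearMap hd a).exists_bound_of_norm_sq_eq (combProj a)
      ((gridSpacing d : ℂ) ^ n) fun ψ => by
        rw [← inner_combAmplitudeLinearMap hd a ψ ψ, inner_self_eq_norm_sq_to_K]
        norm_cast

/-- The key identity `⟨V_a ψ, V_a φ⟩ = ℓⁿ ⟨ψ, K_a φ⟩`. -/
theorem inner_combAmplitude {n d : ℕ} (hd : 0 < d) (a : Fin n → Fin d) (ψ φ : CVSpace n) :
    inner ℂ (combAmplitude hd a ψ) (combAmplitude hd a φ) =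
      (gridSpacing d : ℂ) ^ n * inner ℂ ψ (combProj a φ) :=
  inner_combAmplitudeLinearMap hd a ψ φ

theorem isGKPAmplitude_iff {n d : ℕ} (hd : 0 < d) (a : Fin n → Fin d) (ψ : CVSpace n)
    (A : (Fin n → ℝ) × (Fin n → ℝ) → ℂ) :
    IsGKPAmplitude a ψ A ↔ A =ᵐ[volume.restrict (phaseCell n d)] combAmplitude hd a ψ := by
  have hlim : Tendsto (fun s : Finset (Fin n → ℤ) => ∑ m ∈ s, toothLinearMap d (combPoint a m) ψ)
      atTop (𝓝 (combAmplitude hd a ψ)) := hasSum_combAmplitudeLinearMap hd a ψ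
  have hcoe (s : Finset (Fin n → ℤ)) :
      (∑ m ∈ s, toothLinearMap d (combPoint a m) ψ : CellSpace n d)
        =ᵐ[volume.restrict (phaseCell n d)]
          fun t => ∑ m ∈ s, displacement t ψ (combPoint a m) := by
    have h1 := Lp.coeFn_finsetSum s fun m => toothLinearMap d (combPoint a m) ψ
    have h2 : ∀ᵐ t ∂(volume.restrict (phaseCell n d)), ∀ m : Fin n → ℤ,
        toothLinearMap d (combPoint a m) ψ t = displacement t ψ (combPoint a m) :=
      ae_all_iff.mpr fun m => coeFn_toothLinearMap _ ψ
    filter_upwards [h1, h2] with t h1 h2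
    rw [h1]
    simp [h2]
  have hiff (A' : (Fin n → ℝ) × (Fin n → ℝ) → ℂ)
      (hA : MemLp A' 2 (volume.restrict (phaseCell n d))) :
      Tendsto (fun s : Finset (Fin n → ℤ) => ∑ m ∈ s, toothLinearMap d (combPoint a m) ψ)
        atTop (𝓝 hA.toLp) ↔
      Tendsto (fun s : Finset (Fin n → ℤ) =>
        eLpNorm (fun t => ∑ m ∈ s, displacement t ψ (combPoint a m) - A' t) 2
        (volume.restrict (phaseCell n d))) atTop (𝓝 0) := by
    rw [Lp.tendsto_Lp_iff_tendsto_eLpNorm']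
    refine tendsto_congr fun s => eLpNorm_congr_ae ?_
    filter_upwards [hcoe s, hA.coeFn_toLp] with t h1 h2
    rw [Pi.sub_apply, h1, h2]
  constructor
  · rintro ⟨hA, hT⟩
    have := tendsto_nhds_unique ((hiff A hA).mpr hT) hlim
    rw [← this]
    exact hA.coeFn_toLp.symm
  · intro h
    have hA : MemLp A 2 (volume.restrict (phaseCell n d)) :=
      (memLp_congr_ae h).mpr (Lp.memLp _)
    refine ⟨hA, (hiff A hA).mp ?_⟩
    convert hlim
    exact Lp.ext (hA.coeFn_toLp.trans h)

/-! ### The stabilizer subsystem decomposition -/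

theorem integral_norm_inner_le {α : Type*} [MeasurableSpace α] {μ : Measure α} (f g : Lp ℂ 2 μ) :
    ∫ t, ‖inner ℂ (g t) (f t)‖ ∂μ ≤ ‖f‖ ^ 2 + ‖g‖ ^ 2 := by
  have hsq (h : Lp ℂ 2 μ) : Integrable (fun t => ‖h t‖ ^ 2) μ := (Lp.memLp h).norm.integrable_sq
  have hint (h : Lp ℂ 2 μ) : ∫ t, ‖h t‖ ^ 2 ∂μ = ‖h‖ ^ 2 := by
    have h1 := L2.inner_def (𝕜 := ℂ) h h
    simp only [inner_self_eq_norm_sq_to_K] at h1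
    have h2 : ((‖h‖ ^ 2 : ℝ) : ℂ) = ∫ t, ((‖h t‖ ^ 2 : ℝ) : ℂ) ∂μ := by
      push_cast
      exact h1
    rw [integral_complex_ofReal] at h2
    exact_mod_cast h2.symm
  rw [← hint f, ← hint g, ← integral_add (hsq f) (hsq g)]
  refine integral_mono (L2.integrable_inner g f).norm ((hsq f).add (hsq g)) fun t => ?_
  have := norm_inner_le_norm (𝕜 := ℂ) (g t) (f t)
  dsimp only
  nlinarith [sq_nonneg (‖f t‖ - ‖g t‖), sq_nonneg ‖f t‖, sq_nonneg ‖g t‖]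

/-- For square-summable sequences in `L²`, the pointwise inner products form a series that
converges almost everywhere and in `L¹`, and that may be integrated term by term. -/
theorem hasSum_inner_of_summable_norm_sq {α : Type*} [MeasurableSpace α] {μ : Measure α}
    {f g : ℕ → Lp ℂ 2 μ} (hf : Summable fun k => ‖f k‖ ^ 2) (hg : Summable fun k => ‖g k‖ ^ 2) :
    (∀ᵐ t ∂μ, Summable fun k => inner ℂ (g k t) (f k t)) ∧
      Integrable (fun t => ∑' k, inner ℂ (g k t) (f k t)) μ ∧
      HasSum (fun k => inner ℂ (g k) (f k)) (∫ t, ∑' k, inner ℂ (g k t) (f k t) ∂μ) := by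
  have hi (k : ℕ) : Integrable (fun t => inner ℂ (g k t) (f k t)) μ :=
    L2.integrable_inner (g k) (f k)
  have hs : Summable fun k => ∫ t, ‖inner ℂ (g k t) (f k t)‖ ∂μ :=
    Summable.of_nonneg_of_le (fun k => integral_nonneg fun t => norm_nonneg _)
      (fun k => integral_norm_inner_le (f k) (g k)) (hf.add hg)
  have htop : ∑' k, ‖(hi k).toL1 _‖ₑ ≠ ∞ := by
    rw [tsum_enorm_ne_top_iff_summable_norm]
    exact hs.congr fun k => (L1.norm_of_fun_eq_integral_norm (hi k)).symm
  have hae : ∀ᵐ t ∂μ, HasSum (fun k => inner ℂ (g k t) (f k t))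
      ((∑' k, (hi k).toL1 _ : Lp ℂ 1 μ) t) := by
    filter_upwards [Lp.hasSum_coeFn_tsum htop, ae_all_iff.mpr fun k => (hi k).coeFn_toL1]
      with t h1 h2
    simpa only [h2] using h1
  refine ⟨hae.mono fun t ht => ht.summable, ?_, ?_⟩
  · refine (L1.integrable_coeFn (∑' k, (hi k).toL1 _ : Lp ℂ 1 μ)).congr ?_
    exact hae.mono fun t ht => ht.tsum_eq.symm
  · simp only [L2.inner_def]
    exact hasSum_integral_of_summable_integral_norm hi hs

theorem summable_norm_sq_map {E F : Type*} [NormedAddCommGroup E] [NormedSpace ℂ E]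
    [NormedAddCommGroup F] [NormedSpace ℂ F] (T : E →L[ℂ] F) {φ : ℕ → E}
    (h : Summable fun k => ‖φ k‖ ^ 2) : Summable fun k => ‖T (φ k)‖ ^ 2 := by
  refine Summable.of_nonneg_of_le (fun k => by positivity) (fun k => ?_) (h.mul_left (‖T‖ ^ 2))
  rw [← mul_pow]
  gcongr
  exact T.le_opNorm _

/-- The `k`-series of the integrand of `Tr_S(ρ)` converges, and the entries of the integral are
`∑ₖ ⟨V_b φₖ, V_a φₖ⟩`. -/
theorem hasSum_inner_combAmplitude {n d : ℕ} (hd : 0 < d) {φ : ℕ → CVSpace n}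
    (hφ : Summable fun k => ‖φ k‖ ^ 2)
    {A : ℕ → (Fin n → Fin d) → (Fin n → ℝ) × (Fin n → ℝ) → ℂ}
    (hA : ∀ k a, IsGKPAmplitude a (φ k) (A k a)) (a b : Fin n → Fin d) :
    (∀ᵐ t ∂(volume.restrict (phaseCell n d)),
      Summable fun k => A k a t * (starRingEnd ℂ) (A k b t)) ∧
    IntegrableOn (fun t => ∑' k, A k a t * (starRingEnd ℂ) (A k b t)) (phaseCell n d) ∧
    HasSum (fun k => inner ℂ (combAmplitude hd b (φ k)) (combAmplitude hd a (φ k)))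
      (∫ t in phaseCell n d, ∑' k, A k a t * (starRingEnd ℂ) (A k b t)) := by
  obtain ⟨h1, h2, h3⟩ := hasSum_inner_of_summable_norm_sq
    (summable_norm_sq_map (combAmplitude hd a) hφ) (summable_norm_sq_map (combAmplitude hd b) hφ)
  have hae : ∀ᵐ t ∂(volume.restrict (phaseCell n d)),
      ∀ k, inner ℂ (combAmplitude hd b (φ k) t) (combAmplitude hd a (φ k) t) =
        A k a t * (starRingEnd ℂ) (A k b t) := by
    filter_upwards [ae_all_iff.mpr fun k => (isGKPAmplitude_iff hd a (φ k) _).mp (hA k a),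
      ae_all_iff.mpr fun k => (isGKPAmplitude_iff hd b (φ k) _).mp (hA k b)] with t ha hb k
    rw [RCLike.inner_apply, ha k, hb k]
  have hts : (fun t => ∑' k, inner ℂ (combAmplitude hd b (φ k) t) (combAmplitude hd a (φ k) t))
      =ᵐ[volume.restrict (phaseCell n d)]
        fun t => ∑' k, A k a t * (starRingEnd ℂ) (A k b t) :=
    hae.mono fun t ht => tsum_congr ht
  refine ⟨?_, h2.congr hts, ?_⟩
  · filter_upwards [h1, hae] with t h1 h2
    exact h1.congr h2
  · rwa [integral_congr_ae hts] at h3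

/-- The sum `∑ₖ ⟨V_b φₖ, V_a φₖ⟩` is the trace of `V_b† V_a ρ`, and so it is the same for all
ensembles of `ρ`. -/
theorem tsum_inner_combAmplitude_eq {n d : ℕ} (hd : 0 < d) {ρ : CVSpace n →L[ℂ] CVSpace n}
    {φ φ' : ℕ → CVSpace n} (h : IsEnsemble ρ φ) (h' : IsEnsemble ρ φ') (a b : Fin n → Fin d) :
    ∑' k, inner ℂ (combAmplitude hd b (φ k)) (combAmplitude hd a (φ k)) =
      ∑' k, inner ℂ (combAmplitude hd b (φ' k)) (combAmplitude hd a (φ' k)) := by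
  have hT (x : CVSpace n) : inner ℂ (combAmplitude hd b x) (combAmplitude hd a x) =
      inner ℂ x ((ContinuousLinearMap.adjoint (combAmplitude hd b) ∘L combAmplitude hd a) x) := by
    rw [ContinuousLinearMap.comp_apply, ContinuousLinearMap.adjoint_inner_right]
  obtain ⟨c, hc, ht⟩ := h.exists_hasTrace
    (ContinuousLinearMap.adjoint (combAmplitude hd b) ∘L combAmplitude hd a)
  obtain ⟨c', hc', ht'⟩ := h'.exists_hasTrace
    (ContinuousLinearMap.adjoint (combAmplitude hd b) ∘L combAmplitude hd a)
  simp only [hT]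
  rw [hc.tsum_eq, hc'.tsum_eq, ht.unique ht']

/-- The matrix `ℓ⁻ⁿ ∑ₖ ⟨V_b φₖ, V_a φₖ⟩` of the stabilizer subsystem decomposition, in terms of an
ensemble `φ`. -/
noncomputable def ssdMatrix {n d : ℕ} (hd : 0 < d) (φ : ℕ → CVSpace n) :
    Matrix (Fin n → Fin d) (Fin n → Fin d) ℂ :=
  Matrix.of fun a b => (((gridSpacing d ^ n)⁻¹ : ℝ) : ℂ) *
    ∑' k, inner ℂ (combAmplitude hd b (φ k)) (combAmplitude hd a (φ k))

theorem isSSD_iff {n d : ℕ} (hd : 0 < d) {ρ : CVSpace n →L[ℂ] CVSpace n} {φ : ℕ → CVSpace n}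
    (h : IsEnsemble ρ φ) (M : Matrix (Fin n → Fin d) (Fin n → Fin d) ℂ) :
    IsSSD ρ M ↔ M = ssdMatrix hd φ := by
  constructor
  · rintro ⟨-, hM⟩
    obtain ⟨A, hA, hAM⟩ := hM φ h
    ext a b
    rw [(hAM a b).2.2, ssdMatrix, Matrix.of_apply,
      (hasSum_inner_combAmplitude hd h.1 hA a b).2.2.tsum_eq]
  · rintro rfl
    refine ⟨⟨φ, h⟩, fun φ' h' => ?_⟩
    have hA (k : ℕ) (a : Fin n → Fin d) :
        IsGKPAmplitude a (φ' k) (combAmplitude hd a (φ' k)) :=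
      (isGKPAmplitude_iff hd a (φ' k) _).mpr (EventuallyEq.refl _ _)
    refine ⟨fun k a => combAmplitude hd a (φ' k), hA, fun a b => ?_⟩
    obtain ⟨h1, h2, h3⟩ := hasSum_inner_combAmplitude hd h'.1 hA a b
    refine ⟨h1, h2, ?_⟩
    rw [ssdMatrix, Matrix.of_apply, tsum_inner_combAmplitude_eq hd h h' a b, h3.tsum_eq]

theorem hasSum_ssdMatrix {n d : ℕ} (hd : 0 < d) {φ : ℕ → CVSpace n}
    (hφ : Summable fun k => ‖φ k‖ ^ 2) (a b : Fin n → Fin d) :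
    HasSum (fun k => (((gridSpacing d ^ n)⁻¹ : ℝ) : ℂ) *
      inner ℂ (combAmplitude hd b (φ k)) (combAmplitude hd a (φ k))) (ssdMatrix hd φ a b) := by
  have h := (hasSum_inner_of_summable_norm_sq (summable_norm_sq_map (combAmplitude hd a) hφ)
    (summable_norm_sq_map (combAmplitude hd b) hφ)).2.2
  exact h.summable.hasSum.mul_left _

/-- The diagonal entries are `∑ₖ ⟨φₖ, K_a φₖ⟩`. -/
theorem hasSum_ssdMatrix_diag {n d : ℕ} (hd : 0 < d) {φ : ℕ → CVSpace n}
    (hφ : Summable fun k => ‖φ k‖ ^ 2) (a : Fin n → Fin d) :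
    HasSum (fun k => inner ℂ (φ k) (combProj a (φ k))) (ssdMatrix hd φ a a) := by
  convert hasSum_ssdMatrix hd hφ a a using 2 with k
  have hl : (gridSpacing d : ℂ) ≠ 0 := Complex.ofReal_ne_zero.mpr (gridSpacing_pos hd).ne'
  rw [inner_combAmplitude]
  push_cast
  field_simp

/-- The matrix is a nonnegative multiple of a sum of transposed Gram matrices. -/
theorem posSemidef_ssdMatrix {n d : ℕ} (hd : 0 < d) {φ : ℕ → CVSpace n}
    (hφ : Summable fun k => ‖φ k‖ ^ 2) : (ssdMatrix hd φ).PosSemidef := by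
  set z : ℂ := (((gridSpacing d ^ n)⁻¹ : ℝ) : ℂ) with hz
  have hz0 : 0 ≤ z := by
    have := gridSpacing_pos hd
    exact Complex.zero_le_real.mpr (by positivity)
  set G : ℕ → Matrix (Fin n → Fin d) (Fin n → Fin d) ℂ := fun k =>
    z • (Matrix.gram ℂ fun a => combAmplitude hd a (φ k)).transpose with hG
  have hpos (k : ℕ) : (G k).PosSemidef :=
    (Matrix.posSemidef_gram ℂ fun a => combAmplitude hd a (φ k)).transpose.smul hz0
  have hsum (a b : Fin n → Fin d) : HasSum (fun k => G k a b) (ssdMatrix hd φ a b) :=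
    hasSum_ssdMatrix hd hφ a b
  refine Matrix.PosSemidef.of_dotProduct_mulVec_nonneg ?_ fun x => ?_
  · ext a b
    rw [Matrix.conjTranspose_apply]
    refine HasSum.unique (f := fun k => G k a b) ?_ (hsum a b)
    convert (hsum b a).star using 2 with k
    exact ((hpos k).1.apply a b).symm
  · have hx : HasSum (fun k => star x ⬝ᵥ (G k).mulVec x) (star x ⬝ᵥ (ssdMatrix hd φ).mulVec x) := by
      simp only [dotProduct, Matrix.mulVec]
      exact hasSum_sum fun a _ => (hasSum_sum fun b _ => (hsum a b).mul_right _).mul_left _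
    exact hx.nonneg fun k => (hpos k).dotProduct_mulVec_nonneg x

theorem trace_ssdMatrix {n d : ℕ} (hd : 0 < d) {ρ : CVSpace n →L[ℂ] CVSpace n}
    {φ : ℕ → CVSpace n} (h : IsEnsemble ρ φ) {c : ℂ} (hc : HasTrace ρ c) :
    (ssdMatrix hd φ).trace = c := by
  have h1 : HasSum (fun k => ∑ a : Fin n → Fin d, inner ℂ (φ k) (combProj a (φ k)))
      (ssdMatrix hd φ).trace :=
    hasSum_sum fun a _ => hasSum_ssdMatrix_diag hd h.1 a
  refine h1.unique ?_
  simp only [← inner_sum, sum_combProj hd]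
  exact h.hasSum_norm_sq hc

theorem hasTrace_combProj_comp {n d : ℕ} (hd : 0 < d) {ρ : CVSpace n →L[ℂ] CVSpace n}
    {φ : ℕ → CVSpace n} (h : IsEnsemble ρ φ) (a : Fin n → Fin d) :
    HasTrace (combProj a ∘L ρ) (ssdMatrix hd φ a a) := by
  obtain ⟨c, hs, ht⟩ := h.exists_hasTrace (combProj a)
  rwa [(hasSum_ssdMatrix_diag hd h.1 a).unique hs]

theorem mainTheorem5 (n d : ℕ) (hd : 0 < d)
    (ρ : CVSpace n →L[ℂ] CVSpace n) (hρ : ρ.IsPositive) (τ : ℝ) (hτ : HasTrace ρ (τ : ℂ)) :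
    Set.BijOn (outcomeOf : (Fin n → Fin d) → (Fin n → ℝ)) Set.univ (outcomes n d) ∧
    ∃ M : Matrix (Fin n → Fin d) (Fin n → Fin d) ℂ,
      IsSSD ρ M ∧ (∀ M' : Matrix (Fin n → Fin d) (Fin n → Fin d) ℂ, IsSSD ρ M' → M' = M) ∧
      M.PosSemidef ∧ M.trace = (τ : ℂ) ∧
      ∀ a : Fin n → Fin d, ∃ K : CVSpace n →L[ℂ] CVSpace n,
        IsModularBinOperator d (outcomeOf a) K ∧ HasTrace (K ∘L ρ) (M a a) := by
  obtain ⟨φ, hφ⟩ := exists_isEnsemble hρ hτ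
  exact ⟨bijOn_outcomeOf hd, ssdMatrix hd φ, (isSSD_iff hd hφ _).mpr rfl,
    fun M' => (isSSD_iff hd hφ M').mp, posSemidef_ssdMatrix hd hφ.1, trace_ssdMatrix hd hφ hτ,
    fun a => ⟨combProj a, isModularBinOperator_combProj hd a, hasTrace_combProj_comp hd hφ a⟩⟩
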